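/- Fix a nonstandard extension $*$, that is, an assignment $X\mapsto{}^*X$, $f\mapsto{}^*f$ on sets and maps that satisfies the transfer principle (no particular construction is required). Let $B$ be an internal Dedekind ring, i.e. an element of ${}^*\mathcal D$ for some set $\mathcal D$ of Dedekind domains (e.g. an ultraproduct of Dedekind domains). Let $\mathcal M$ be the set of internal maximal ideals of $B$ and let $\mathcal L={}^*\mathcal P_{fin}(\mathcal M)$ be the lattice of hyperfinite subsets of $\mathcal M$. A filter on $\mathcal L$ is a subset closed under $\cap$ and under passing to larger sets of $\mathcal L$; an ultrafilter is a maximal proper filter. For $a\in B$ put $V(a)=\{\mathfrak p\in\mathcal M\mid a\in\mathfrak p\}$. Let $\mathfrak m$ be a (not necessarily internal) maximal ideal of $B$ and let $\mathcal F$ be the filter on $\mathcal L$ generated by the sets $V(a)$, $a\in\mathfrak m$, i.e. the set of all $S\in\mathcal L$ that contain $V(a_1)\cap\dots\cap V(a_n)$ for some finitely many $a_1,\dots,a_n\in\mathfrak m$. Then: 1. $\mathcal F$ is an ultrafilter on $\mathcal L$, and it corresponds to $\mathfrak m$: $\mathfrak m=\{a\in B\mid a=0 \text{ or } V(a)\in\mathcal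 F\}$. 2. Let ${}^*\prod_{\mathfrak p\in\mathcal M}B/\mathfrak p$ be the ring of internal functions $f$ on $\mathcal M$ with $f(\mathfrak p)$ in the internal residue field $B/\mathfrak p$ for all $\mathfrak p \in \mathcal M$, and let $\big({}^*\prod_{\mathfrak p\in\mathcal M}B/\mathfrak p\big)/\mathcal F$ be its quotient in which two functions are identified if they agree on some $F\in\mathcal F$. The diagonal map $b\mapsto(b \bmod \mathfrak p)_{\mathfrak p}$ induces a ring isomorphism $$B/\mathfrak m\;\cong\;\Big({}^*\prod_{\mathfrak p\in\mathcal M}B/\mathfrak p\Big)\Big/\mathcal F .$$ 3. If $\mathfrak m$ is internal, then $\mathfrak m \in \mathcal M$, the ultrafilter $\mathcal F$ is principal with least element $\{\mathfrak m\}$, and evaluation of functions at $\mathfrak m$ induces an isomorphism of the ultraproduct $\big({}^*\prod_{\mathfrak p\in\mathcal M}B/\mathfrak p\big)/\mathcal F$ onto the internal residue field $B/\mathfrak m$; moreover the internal residue field at $\mathfrak m$ is the ordinary quotient ring $B/\mathfrak m$, via $b\mapsto b\bmod\mathfrak m$. -/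

import Mathlib

universe u v

/-- A nonstandard extension (in its functorial form): every set `X` has an extension `*X`, every map
`f : X → Y` has an extension `*f : *X → *Y`, compatibly with identities and composition, and
`*` preserves the one-point set, binary products and disjoint unions.

These axioms are the transfer principle: preservation of disjoint unions makes `*` commute with
the Boolean operations on subsets (so with `∧`, `∨`, `¬`), preservation of products lets formulas
have several variables and makes equality transfer, and preservation of surjections (they split)
makes `∃` transfer.  Sets of higher type are covered because `X` may itself be a set of subsets, of
functions, of ideals, and so on; the elements of `*(Set X)` are the internal subsets of `*X`.
The map `X ↦ X^J / U` for any ultrafilter `U` on any set `J` is an example, but no particular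
construction is required, and no saturation is imposed. -/
structure NonstandardExtension where
  /-- the extension `*X` of a set `X` -/
  star : Type u → Type v
  /-- the extension `*f` of a map `f` -/
  map : ∀ {X Y : Type u}, (X → Y) → star X → star Y
  map_id : ∀ {X : Type u} (x : star X), map (fun y : X => y) x = x
  map_map : ∀ {X Y Z : Type u} (g : Y → Z) (f : X → Y) (x : star X),
    map g (map f x) = map (fun y => g (f y)) x
  existsUnique_star_punit : ∃! _x : star PUnit.{u + 1}, True
  bijective_prod : ∀ X Y : Type u, Function.Bijective
    (fun z : star (X × Y) => (map Prod.fst z, map Prod.snd z))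
  bijective_sum : ∀ X Y : Type u, Function.Bijective
    (Sum.elim (map Sum.inl) (map Sum.inr) : star X ⊕ star Y → star (X ⊕ Y))

namespace NonstandardExtension

variable (E : NonstandardExtension.{u, v})

/-- The extension `*s ⊆ *X` of a subset `s ⊆ X`. -/
def starSet {X : Type u} (s : Set X) : Set (E.star X) :=
  Set.range (E.map (Subtype.val : s → X))

section Transfer

variable {X Y : Type u}

theorem map_inl_ne_map_inr (x : E.star X) (y : E.star Y) :
    E.map (Sum.inl : X → X ⊕ Y) x ≠ E.map (Sum.inr : Y → X ⊕ Y) y := by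
  intro h
  have := (E.bijective_sum X Y).1 (a₁ := Sum.inl x) (a₂ := Sum.inr y) h
  cases this

theorem isEmpty_star [IsEmpty X] : IsEmpty (E.star X) := by
  refine ⟨fun x => E.map_inl_ne_map_inr x x ?_⟩
  congr 1
  funext a
  exact isEmptyElim a

theorem map_injective {f : X → Y} (hf : Function.Injective f) : Function.Injective (E.map f) := by
  rcases isEmpty_or_nonempty X with h | h
  · intro x
    exact (E.isEmpty_star (X := X)).elim x
  · intro x y hxy
    have h2 := congrArg (E.map (Function.invFun f)) hxy
    simp only [E.map_map, Function.leftInverse_invFun hf _] at h2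
    simpa only [E.map_id] using h2

theorem map_mem_starSet_of_forall (f : X → Y) (t : Set Y) (h : ∀ x, f x ∈ t) (x : E.star X) :
    E.map f x ∈ E.starSet t :=
  ⟨E.map (fun y => ⟨f y, h y⟩) x, by rw [E.map_map]⟩

theorem mem_starSet_or (s : Set X) (x : E.star X) : x ∈ E.starSet s ∨ x ∈ E.starSet sᶜ := by
  classical
  let g : X → s ⊕ (sᶜ : Set X) := fun y => if h : y ∈ s then Sum.inl ⟨y, h⟩ else Sum.inr ⟨y, h⟩
  let k : s ⊕ (sᶜ : Set X) → X := Sum.elim Subtype.val Subtype.val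
  have hkg : ∀ y, k (g y) = y := by
    intro y
    by_cases h : y ∈ s <;> simp [k, g, h]
  have hx : x = E.map k (E.map g x) := by
    rw [E.map_map]
    simp only [hkg, E.map_id]
  obtain ⟨z | z, hz⟩ := (E.bijective_sum s (sᶜ : Set X)).2 (E.map g x)
  · left
    refine ⟨z, ?_⟩
    rw [hx, ← hz, Sum.elim_inl, E.map_map]
    rfl
  · right
    refine ⟨z, ?_⟩
    rw [hx, ← hz, Sum.elim_inr, E.map_map]
    rfl

theorem notMem_starSet_compl (s : Set X) (x : E.star X) (h : x ∈ E.starSet s) :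
    x ∉ E.starSet sᶜ := by
  classical
  obtain ⟨y, rfl⟩ := h
  rintro ⟨z, hz⟩
  let g : X → s ⊕ (sᶜ : Set X) := fun y => if h : y ∈ s then Sum.inl ⟨y, h⟩ else Sum.inr ⟨y, h⟩
  have h1 : ∀ y : s, g y.1 = Sum.inl y := fun y => by simp [g, y.2]
  have h2 : ∀ y : (sᶜ : Set X), g y.1 = Sum.inr y := fun y => by
    have : y.1 ∉ s := y.2
    simp [g, this]
  have h3 := congrArg (E.map g) hz
  simp only [E.map_map, h1, h2] at h3
  exact E.map_inl_ne_map_inr _ _ h3.symm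

theorem map_mem_starSet (f : X → Y) (t : Set Y) (x : E.star X) :
    E.map f x ∈ E.starSet t ↔ x ∈ E.starSet (f ⁻¹' t) := by
  have key : ∀ t : Set Y, x ∈ E.starSet (f ⁻¹' t) → E.map f x ∈ E.starSet t := by
    rintro t ⟨y, rfl⟩
    rw [E.map_map]
    exact E.map_mem_starSet_of_forall _ _ (fun z => z.2) y
  refine ⟨fun h => ?_, key t⟩
  rcases E.mem_starSet_or (f ⁻¹' t) x with h1 | h1
  · exact h1
  · exact absurd (key tᶜ h1) (E.notMem_starSet_compl _ _ h)

theorem starSet_mono {s t : Set X} (h : s ⊆ t) : E.starSet s ⊆ E.starSet t := by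
  rintro _ ⟨y, rfl⟩
  exact E.map_mem_starSet_of_forall _ _ (fun z => h z.2) y

theorem mem_starSet_inter {s t : Set X} {x : E.star X} (hs : x ∈ E.starSet s)
    (ht : x ∈ E.starSet t) : x ∈ E.starSet (s ∩ t) := by
  obtain ⟨y, rfl⟩ := hs
  rw [E.map_mem_starSet] at ht
  obtain ⟨z, rfl⟩ := ht
  rw [E.map_map]
  exact E.map_mem_starSet_of_forall (fun z : ((Subtype.val : s → X) ⁻¹' t) => z.1.1) (s ∩ t)
    (fun z => ⟨z.1.2, z.2⟩) z

theorem mem_starSet_eq {f g : X → Y} {x : E.star X} (h : E.map f x = E.map g x) :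
    x ∈ E.starSet {y | f y = g y} := by
  rcases E.mem_starSet_or {y | f y = g y} x with h1 | h1
  · exact h1
  · exfalso
    let Δ : Set (Y × Y) := {z | z.1 = z.2}
    have e : E.map (fun y => (f y, g y)) x = E.map (fun y => (f y, f y)) x := by
      apply (E.bijective_prod Y Y).1
      simp only [E.map_map, Prod.mk.injEq, true_and]
      exact h.symm
    have h2 : E.map (fun y => (f y, f y)) x ∈ E.starSet Δ :=
      E.map_mem_starSet_of_forall (fun y => (f y, f y)) Δ (fun _ => rfl) x
    rw [← e, E.map_mem_starSet] at h2
    exact E.notMem_starSet_compl _ _ h2 h1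

end Transfer

variable {I : Type u}

/-- Let `T = (T i)` be a family of sets indexed by `I` and `i₀ ∈ *I`.  This is the internal set
`*T_{i₀}`, the value at `i₀` of the extended family, i.e. the fibre over `i₀` of
`*(⨆ T i) → *I`.  The internal sets that are elements of `*{T i}` are exactly these.  (For an
ultrapower and `i₀` the class of `(i_j)_j` it is the ultraproduct of the sets `T (i_j)`.) -/
def Internal (i₀ : E.star I) (T : I → Type u) : Type v :=
  {x : E.star (Σ i, T i) // E.map Sigma.fst x = i₀}

namespace Internal

variable {E} {i₀ : E.star I} {T T₁ T₂ T₃ : I → Type u}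

/-- The internal map `*T_{i₀} → *T₁_{i₀}` given by a family of maps `T i → T₁ i`. -/
def map (f : ∀ i, T i → T₁ i) (x : E.Internal i₀ T) : E.Internal i₀ T₁ :=
  ⟨E.map (fun z => ⟨z.1, f z.1 z.2⟩) x.1, by rw [E.map_map]; exact x.2⟩

/-- The internal element given by a family of elements. -/
def const (c : ∀ i, T i) : E.Internal i₀ T :=
  ⟨E.map (fun i => ⟨i, c i⟩) i₀, by rw [E.map_map]; exact E.map_id _⟩

/-- The internal statement `*P(x)`, where `P` is a family of predicates. -/
def Holds (P : ∀ i, T i → Prop) (x : E.Internal i₀ T) : Prop :=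
  x.1 ∈ E.starSet {z : Σ i, T i | P z.1 z.2}

theorem map_map (g : ∀ i, T₁ i → T₂ i) (f : ∀ i, T i → T₁ i) (x : E.Internal i₀ T) :
    map g (map f x) = map (fun i y => g i (f i y)) x :=
  Subtype.ext (E.map_map _ _ _)

theorem map_id (x : E.Internal i₀ T) : map (fun _ y => y) x = x :=
  Subtype.ext (E.map_id _)

theorem map_const (f : ∀ i, T i → T₁ i) (c : ∀ i, T i) :
    map f (const c : E.Internal i₀ T) = const (fun i => f i (c i)) :=
  Subtype.ext (E.map_map _ _ _)

theorem const_eq_map (c : ∀ i, T₁ i) (x : E.Internal i₀ T) :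
    (const c : E.Internal i₀ T₁) = map (fun i _ => c i) x := by
  obtain ⟨x, rfl⟩ := x
  exact Subtype.ext (E.map_map _ _ _)

theorem exists_pair (x : E.Internal i₀ T₁) (y : E.Internal i₀ T₂) :
    ∃ w : E.Internal i₀ (fun i => T₁ i × T₂ i),
      map (fun _ z => z.1) w = x ∧ map (fun _ z => z.2) w = y := by
  obtain ⟨z, hz⟩ := (E.bijective_prod (Σ i, T₁ i) (Σ i, T₂ i)).2 (x.1, y.1)
  obtain ⟨hx, hy⟩ := Prod.mk.inj hz
  have h : E.map (fun z : (Σ i, T₁ i) × (Σ i, T₂ i) => z.1.1) z = E.map (fun z => z.2.1) z := by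
    have h1 := congrArg (E.map Sigma.fst) hx
    have h2 := congrArg (E.map Sigma.fst) hy
    rw [E.map_map] at h1 h2
    rw [h1, h2, x.2, y.2]
  obtain ⟨w, hw⟩ := E.mem_starSet_eq h
  let k : {z : (Σ i, T₁ i) × (Σ i, T₂ i) | z.1.1 = z.2.1} → Σ i, T₁ i × T₂ i :=
    fun z => ⟨z.1.1.1, z.1.1.2, cast (congrArg T₂ z.2.symm) z.1.2.2⟩
  have k1 : ∀ z, (⟨(k z).1, (k z).2.1⟩ : Σ i, T₁ i) = z.1.1 := fun _ => rfl
  have k2 : ∀ z, (⟨(k z).1, (k z).2.2⟩ : Σ i, T₂ i) = z.1.2 := by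
    rintro ⟨⟨⟨i, a⟩, ⟨j, b⟩⟩, h⟩
    obtain rfl : i = j := h
    rfl
  refine ⟨⟨E.map k w, ?_⟩, Subtype.ext ?_, Subtype.ext ?_⟩
  · rw [E.map_map, ← x.2, ← hx, ← hw, E.map_map, E.map_map]
  · change E.map _ (E.map k w) = _
    rw [E.map_map, ← hx, ← hw, E.map_map]
  · change E.map _ (E.map k w) = _
    rw [E.map_map, ← hy, ← hw, E.map_map]
    simp only [k2]

/-- The internal pair `(x, y)`. -/
noncomputable def pair (x : E.Internal i₀ T₁) (y : E.Internal i₀ T₂) :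
    E.Internal i₀ (fun i => T₁ i × T₂ i) :=
  (exists_pair x y).choose

theorem map_fst_pair (x : E.Internal i₀ T₁) (y : E.Internal i₀ T₂) :
    map (fun _ z => z.1) (pair x y) = x := (exists_pair x y).choose_spec.1

theorem map_snd_pair (x : E.Internal i₀ T₁) (y : E.Internal i₀ T₂) :
    map (fun _ z => z.2) (pair x y) = y := (exists_pair x y).choose_spec.2

theorem ext_pair {w w' : E.Internal i₀ (fun i => T₁ i × T₂ i)}
    (h₁ : map (fun _ z => z.1) w = map (fun _ z => z.1) w')
    (h₂ : map (fun _ z => z.2) w = map (fun _ z => z.2) w') : w = w' := by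
  let k : (Σ i, T₁ i × T₂ i) → (Σ i, T₁ i) × (Σ i, T₂ i) :=
    fun z => (⟨z.1, z.2.1⟩, ⟨z.1, z.2.2⟩)
  have hk : Function.Injective k := by
    rintro ⟨i, a, b⟩ ⟨j, c, d⟩ h
    simp only [k, Prod.mk.injEq, Sigma.mk.injEq] at h
    obtain ⟨⟨rfl, h1⟩, ⟨_, h2⟩⟩ := h
    rw [eq_of_heq h1, eq_of_heq h2]
  apply Subtype.ext
  apply E.map_injective hk
  apply (E.bijective_prod _ _).1
  simp only [E.map_map]
  exact Prod.ext (congrArg Subtype.val h₁) (congrArg Subtype.val h₂)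

theorem pair_map (f : ∀ i, T i → T₁ i) (g : ∀ i, T i → T₂ i) (w : E.Internal i₀ T) :
    pair (map f w) (map g w) = map (fun i z => (f i z, g i z)) w := by
  apply ext_pair
  · rw [map_fst_pair, map_map]
  · rw [map_snd_pair, map_map]

/-- The internal map of two variables given by a family of maps of two variables. -/
noncomputable def map₂ (f : ∀ i, T₁ i → T₂ i → T₃ i) (x : E.Internal i₀ T₁)
    (y : E.Internal i₀ T₂) : E.Internal i₀ T₃ :=
  map (fun i z => f i z.1 z.2) (pair x y)

/-- The internal statement `*R(x, y)`, where `R` is a family of relations. -/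
def Rel (R : ∀ i, T₁ i → T₂ i → Prop) (x : E.Internal i₀ T₁) (y : E.Internal i₀ T₂) : Prop :=
  Holds (fun i z => R i z.1 z.2) (pair x y)

theorem map₂_map (h : ∀ i, T₁ i → T₂ i → T₃ i) (f : ∀ i, T i → T₁ i) (g : ∀ i, T i → T₂ i)
    (w : E.Internal i₀ T) : map₂ h (map f w) (map g w) = map (fun i z => h i (f i z) (g i z)) w := by
  rw [map₂, pair_map, map_map]

theorem holds_map (P : ∀ i, T₁ i → Prop) (f : ∀ i, T i → T₁ i) (w : E.Internal i₀ T) :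
    Holds P (map f w) ↔ Holds (fun i z => P i (f i z)) w :=
  E.map_mem_starSet _ _ _

theorem rel_map (R : ∀ i, T₁ i → T₂ i → Prop) (f : ∀ i, T i → T₁ i) (g : ∀ i, T i → T₂ i)
    (w : E.Internal i₀ T) : Rel R (map f w) (map g w) ↔ Holds (fun i z => R i (f i z) (g i z)) w := by
  rw [Rel, pair_map, holds_map]

theorem Holds.mono {P Q : ∀ i, T i → Prop} {w : E.Internal i₀ T} (h : Holds P w)
    (hPQ : ∀ i z, P i z → Q i z) : Holds Q w :=
  E.starSet_mono (fun z hz => hPQ z.1 z.2 hz) h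

theorem Holds.and {P Q : ∀ i, T i → Prop} {w : E.Internal i₀ T} (h : Holds P w) (h' : Holds Q w) :
    Holds (fun i z => P i z ∧ Q i z) w :=
  E.mem_starSet_inter h h'

theorem holds_of_forall {P : ∀ i, T i → Prop} (h : ∀ i z, P i z) (w : E.Internal i₀ T) :
    Holds P w :=
  ⟨E.map (fun z => ⟨z, h z.1 z.2⟩) w.1, by rw [E.map_map]; exact E.map_id _⟩

theorem exists_map_two (x : E.Internal i₀ T₁) (y : E.Internal i₀ T₂) :
    ∃ w : E.Internal i₀ (fun i => T₁ i × T₂ i),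
      x = map (fun _ z => z.1) w ∧ y = map (fun _ z => z.2) w :=
  ⟨pair x y, (map_fst_pair x y).symm, (map_snd_pair x y).symm⟩

theorem exists_map_three (x : E.Internal i₀ T₁) (y : E.Internal i₀ T₂) (z : E.Internal i₀ T₃) :
    ∃ w : E.Internal i₀ (fun i => T₁ i × T₂ i × T₃ i),
      x = map (fun _ z => z.1) w ∧ y = map (fun _ z => z.2.1) w ∧
        z = map (fun _ z => z.2.2) w := by
  refine ⟨pair x (pair y z), (map_fst_pair _ _).symm, ?_, ?_⟩
  · have h := map_map (fun _ z => z.1) (fun _ z => z.2) (pair x (pair y z))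
    rw [map_snd_pair, map_fst_pair] at h
    exact h
  · have h := map_map (fun _ z => z.2) (fun _ z => z.2) (pair x (pair y z))
    rw [map_snd_pair, map_snd_pair] at h
    exact h

noncomputable instance [∀ i, Add (T i)] : Add (E.Internal i₀ T) := ⟨map₂ (fun _ a b => a + b)⟩
noncomputable instance [∀ i, Mul (T i)] : Mul (E.Internal i₀ T) := ⟨map₂ (fun _ a b => a * b)⟩
instance [∀ i, Neg (T i)] : Neg (E.Internal i₀ T) := ⟨map (fun _ a => -a)⟩
instance [∀ i, Zero (T i)] : Zero (E.Internal i₀ T) := ⟨const (fun _ => 0)⟩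
instance [∀ i, One (T i)] : One (E.Internal i₀ T) := ⟨const (fun _ => 1)⟩

/-- An internal ring, with its internal operations, is a commutative ring. -/
noncomputable instance [∀ i, CommRing (T i)] : CommRing (E.Internal i₀ T) where
  nsmul := nsmulRec
  zsmul := zsmulRec
  add_assoc x y z := by
    obtain ⟨w, rfl, rfl, rfl⟩ := exists_map_three x y z
    change map₂ _ (map₂ _ _ _) _ = map₂ _ _ (map₂ _ _ _)
    simp only [map₂_map, add_assoc]
  zero_add x := by
    change map₂ _ (const _) x = x
    rw [const_eq_map _ x]
    conv_lhs => rw [← map_id x, map_map, map₂_map]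
    simp only [zero_add, map_id]
  add_zero x := by
    change map₂ _ x (const _) = x
    rw [const_eq_map _ x]
    conv_lhs => rw [← map_id x, map_map, map₂_map]
    simp only [add_zero, map_id]
  add_comm x y := by
    obtain ⟨w, rfl, rfl⟩ := exists_map_two x y
    change map₂ _ _ _ = map₂ _ _ _
    simp only [map₂_map, add_comm]
  left_distrib x y z := by
    obtain ⟨w, rfl, rfl, rfl⟩ := exists_map_three x y z
    change map₂ _ _ (map₂ _ _ _) = map₂ _ (map₂ _ _ _) (map₂ _ _ _)
    simp only [map₂_map, mul_add]
  right_distrib x y z := by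
    obtain ⟨w, rfl, rfl, rfl⟩ := exists_map_three x y z
    change map₂ _ (map₂ _ _ _) _ = map₂ _ (map₂ _ _ _) (map₂ _ _ _)
    simp only [map₂_map, add_mul]
  zero_mul x := by
    change map₂ _ (const _) x = const _
    rw [const_eq_map _ x]
    conv_lhs => rw [← map_id x, map_map, map₂_map]
    simp only [zero_mul]
  mul_zero x := by
    change map₂ _ x (const _) = const _
    rw [const_eq_map _ x]
    conv_lhs => rw [← map_id x, map_map, map₂_map]
    simp only [mul_zero]
  mul_assoc x y z := by
    obtain ⟨w, rfl, rfl, rfl⟩ := exists_map_three x y z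
    change map₂ _ (map₂ _ _ _) _ = map₂ _ _ (map₂ _ _ _)
    simp only [map₂_map, mul_assoc]
  one_mul x := by
    change map₂ _ (const _) x = x
    rw [const_eq_map _ x]
    conv_lhs => rw [← map_id x, map_map, map₂_map]
    simp only [one_mul, map_id]
  mul_one x := by
    change map₂ _ x (const _) = x
    rw [const_eq_map _ x]
    conv_lhs => rw [← map_id x, map_map, map₂_map]
    simp only [mul_one, map_id]
  neg_add_cancel x := by
    change map₂ _ (map _ x) x = const _
    rw [const_eq_map _ x]
    conv_lhs => enter [3]; rw [← map_id x]
    simp only [map₂_map, neg_add_cancel]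
  mul_comm x y := by
    obtain ⟨w, rfl, rfl⟩ := exists_map_two x y
    change map₂ _ _ _ = map₂ _ _ _
    simp only [map₂_map, mul_comm]

theorem add_def [∀ i, CommRing (T i)] (x y : E.Internal i₀ T) :
    x + y = map₂ (fun _ a b => a + b) x y := rfl

theorem mul_def [∀ i, CommRing (T i)] (x y : E.Internal i₀ T) :
    x * y = map₂ (fun _ a b => a * b) x y := rfl

theorem zero_def [∀ i, CommRing (T i)] : (0 : E.Internal i₀ T) = const (fun _ => 0) := rfl

/-- An internal lattice, with its internal operations, is a lattice. -/
noncomputable instance [∀ i, Lattice (T i)] : Lattice (E.Internal i₀ T) :=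
  letI : Max (E.Internal i₀ T) := ⟨map₂ (fun _ a b => a ⊔ b)⟩
  letI : Min (E.Internal i₀ T) := ⟨map₂ (fun _ a b => a ⊓ b)⟩
  Lattice.mk'
    (fun x y => by
      obtain ⟨w, rfl, rfl⟩ := exists_map_two x y
      change map₂ _ _ _ = map₂ _ _ _
      simp only [map₂_map, sup_comm])
    (fun x y z => by
      obtain ⟨w, rfl, rfl, rfl⟩ := exists_map_three x y z
      change map₂ _ (map₂ _ _ _) _ = map₂ _ _ (map₂ _ _ _)
      simp only [map₂_map, sup_assoc])
    (fun x y => by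
      obtain ⟨w, rfl, rfl⟩ := exists_map_two x y
      change map₂ _ _ _ = map₂ _ _ _
      simp only [map₂_map, inf_comm])
    (fun x y z => by
      obtain ⟨w, rfl, rfl, rfl⟩ := exists_map_three x y z
      change map₂ _ (map₂ _ _ _) _ = map₂ _ _ (map₂ _ _ _)
      simp only [map₂_map, inf_assoc])
    (fun x y => by
      obtain ⟨w, rfl, rfl⟩ := exists_map_two x y
      change map₂ _ _ (map₂ _ _ _) = _
      simp only [map₂_map, sup_inf_self])
    (fun x y => by
      obtain ⟨w, rfl, rfl⟩ := exists_map_two x y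
      change map₂ _ _ (map₂ _ _ _) = _
      simp only [map₂_map, inf_sup_self])

end Internal

open Internal

section Rings

variable (i₀ : E.star I) (A : I → Type u) [∀ i, CommRing (A i)]

/-- The set `*Id(B)` of internal ideals of the internal ring `B = *A_{i₀}`. -/
abbrev InternalIdeal : Type v := E.Internal i₀ (fun i => Ideal (A i))

/-- The set `𝓜` of internal maximal ideals of the internal ring `B = *A_{i₀}`. -/
abbrev InternalMax : Type v := E.Internal i₀ (fun i => MaximalSpectrum (A i))

/-- The lattice `𝓛 = *P_fin(𝓜)` of hyperfinite subsets of `𝓜`, ordered by inclusion, with internal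
union and intersection as `⊔` and `⊓`. -/
abbrev HyperfiniteSets : Type v := E.Internal i₀ (fun i => Finset (MaximalSpectrum (A i)))

open Classical in
noncomputable instance : Lattice (E.HyperfiniteSets i₀ A) := inferInstance

/-- The internal product `*∏_{𝔭 ∈ 𝓜} B/𝔭`: the internal functions that send each internal maximal
ideal `𝔭` of `B` to an element of the internal residue field `B/𝔭`. -/
abbrev InternalProd : Type v :=
  E.Internal i₀ (fun i => ∀ P : MaximalSpectrum (A i), A i ⧸ P.asIdeal)

variable {E i₀ A}

/-- The internal residue field `B/𝔭` of `B` at an internal maximal ideal `𝔭`: the value at `𝔭` of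
the extension of the family `(A i / P)`, indexed by all `i` and all maximal ideals `P` of `A i`. -/
abbrev InternalResidue (p : E.InternalMax i₀ A) : Type v :=
  E.Internal p.1 (fun j : Σ i, MaximalSpectrum (A i) => A j.1 ⧸ j.2.asIdeal)

/-- The ideal of `B` (in the usual sense) that is formed by the elements of an internal ideal. -/
noncomputable def InternalIdeal.toIdeal (J : E.InternalIdeal i₀ A) : Ideal (E.Internal i₀ A) where
  carrier := {x | Rel (fun _ a K => a ∈ K) x J}
  zero_mem' := by
    rw [Set.mem_ofPred_eq, zero_def, const_eq_map _ J]
    have := (rel_map (fun i (a : A i) (K : Ideal (A i)) => a ∈ K) (fun _ _ => 0)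
      (fun _ K => K) J).2 (holds_of_forall (fun _ K => K.zero_mem) J)
    rwa [show Internal.map (fun _ K => K) J = J from Internal.map_id J] at this
  add_mem' := by
    intro x y hx hy
    obtain ⟨w, rfl, rfl, rfl⟩ := exists_map_three x y J
    simp only [Set.mem_ofPred_eq, add_def, rel_map, map₂_map] at hx hy ⊢
    exact (hx.and hy).mono (fun _ z h => z.2.2.add_mem h.1 h.2)
  smul_mem' := by
    intro c x hx
    obtain ⟨w, rfl, rfl, rfl⟩ := exists_map_three c x J
    simp only [Set.mem_ofPred_eq, smul_eq_mul, mul_def, rel_map, map₂_map] at hx ⊢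
    exact hx.mono (fun _ z h => z.2.2.mul_mem_left _ h)

/-- An ideal of `B` is internal if it is formed by the elements of an internal ideal. -/
def IsInternalIdeal (m : Ideal (E.Internal i₀ A)) : Prop :=
  ∃ J : E.InternalIdeal i₀ A, J.toIdeal = m

/-- An internal maximal ideal as an ideal of `B`. -/
noncomputable def InternalMax.toIdeal (p : E.InternalMax i₀ A) : Ideal (E.Internal i₀ A) :=
  InternalIdeal.toIdeal (Internal.map (fun _ P => P.asIdeal) p)

/-- The internal maximal ideal `p` belongs to the hyperfinite set `S`. -/
def InternalMax.MemSet (p : E.InternalMax i₀ A) (S : E.HyperfiniteSets i₀ A) : Prop :=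
  Rel (fun _ P s => P ∈ s) p S

/-- The hyperfinite set `{p}`. -/
def InternalMax.singleton (p : E.InternalMax i₀ A) : E.HyperfiniteSets i₀ A :=
  Internal.map (fun _ P => {P}) p

/-- The value `f(p) ∈ B/p` of an internal function `f ∈ *∏ B/𝔭` at an internal maximal ideal. -/
noncomputable def InternalProd.eval (f : E.InternalProd i₀ A) (p : E.InternalMax i₀ A) :
    InternalResidue p :=
  ⟨E.map (fun z : Σ i, (∀ P : MaximalSpectrum (A i), A i ⧸ P.asIdeal) × MaximalSpectrum (A i) =>
      (⟨⟨z.1, z.2.2⟩, z.2.1 z.2.2⟩ :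
        Σ j : (Σ i, MaximalSpectrum (A i)), A j.1 ⧸ j.2.asIdeal)) (pair f p).1, by
    rw [E.map_map]
    exact congrArg Subtype.val (map_snd_pair f p)⟩

/-- The diagonal map `B → *∏ B/𝔭`, which sends `b` to the internal function `𝔭 ↦ b mod 𝔭`. -/
def diag (b : E.Internal i₀ A) : E.InternalProd i₀ A :=
  Internal.map (fun _ a P => Ideal.Quotient.mk P.asIdeal a) b

/-- Two internal functions that are compared modulo `F` are identified if they agree on some
hyperfinite set in `F`; this is the ideal of those identified with `0`.  (When `F` is a nonempty
filter, the generating set is already an ideal.) -/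
noncomputable def vanishingIdeal (F : Set (E.HyperfiniteSets i₀ A)) : Ideal (E.InternalProd i₀ A) :=
  Ideal.span {f | ∃ S ∈ F, ∀ p : E.InternalMax i₀ A, p.MemSet S → f.eval p = 0}

/-- The ultraproduct `(*∏_{𝔭 ∈ 𝓜} B/𝔭) / F` (for an ultrafilter `F` on `𝓛`). -/
abbrev Ultraproduct (F : Set (E.HyperfiniteSets i₀ A)) : Type v :=
  E.InternalProd i₀ A ⧸ vanishingIdeal F

/-- The filter on `𝓛` that belongs to an ideal `m` of `B`, generated by the sets
`V(a) = {𝔭 ∈ 𝓜 | a ∈ 𝔭}` for `a ∈ m`: it consists of the hyperfinite sets that contain a finite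
intersection of such sets. -/
def filterOf (m : Ideal (E.Internal i₀ A)) : Set (E.HyperfiniteSets i₀ A) :=
  {S | ∃ t : Finset (E.Internal i₀ A), (∀ a ∈ t, a ∈ m) ∧
    ∀ p : E.InternalMax i₀ A, (∀ a ∈ t, a ∈ p.toIdeal) → p.MemSet S}

end Rings

end NonstandardExtension

/-- A filter of a lattice. -/
structure IsLatticeFilter {L : Type*} [Lattice L] (F : Set L) : Prop where
  inf_mem : ∀ a ∈ F, ∀ b ∈ F, a ⊓ b ∈ F
  sup_mem : ∀ a ∈ F, ∀ b : L, a ⊔ b ∈ F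

/-- An ultrafilter of a lattice: a maximal element among the proper filters. -/
def IsLatticeUltrafilter {L : Type*} [Lattice L] (F : Set L) : Prop :=
  Maximal (fun G : Set L => IsLatticeFilter G ∧ G ≠ Set.univ) F

/-- A filter of a lattice is principal if it has a least element. -/
def IsPrincipalFilter {L : Type*} [Lattice L] (F : Set L) : Prop :=
  ∃ a, IsLeast F a

/-!
A maximal ideal `m` of `B` need not be internal, but its finitely generated subideals are, so that
finitely many elements of `m` always lie in a common internal maximal ideal. Hence an element of `B`
that vanishes on a member of `filterOf m` cannot be a unit modulo `m`, i.e. it lies in `m`. The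
internal Chinese remainder theorem represents every internal function by an element of `B` on any
given hyperfinite set. Together these show that the diagonal map `B → (*∏ B/𝔭) / F` is onto with
kernel `m`, where `F = filterOf m`. In particular the quotient is a domain, and there the
characteristic function of a hyperfinite set `S`, being idempotent, is `0` or `1`: either some
member of `F` is disjoint from `S`, or `S` itself belongs to `F`. So `F` is an ultrafilter, and it
contains `{𝔭}` if `m` is the internal maximal ideal `𝔭`.
-/

/-- A ring of finite character: every nonzero element lies in only finitely many maximal ideals.
This is what makes `V(a)` hyperfinite for nonzero `a`. -/
class HasFiniteCharacter (R : Type*) [CommRing R] : Prop where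
  finite_setOf_mem : ∀ {a : R}, a ≠ 0 → {P : MaximalSpectrum R | a ∈ P.asIdeal}.Finite

instance HasFiniteCharacter.of_dimensionLEOne {R : Type*} [CommRing R] [IsNoetherianRing R]
    [Ring.DimensionLEOne R] : HasFiniteCharacter R where
  finite_setOf_mem {a} ha := by
    refine .of_finite_image (f := MaximalSpectrum.asIdeal)
      ((Ideal.finite_minimalPrimes_of_isNoetherianRing R (Ideal.span {a})).subset ?_)
      fun P _ Q _ h => MaximalSpectrum.ext h
    rintro _ ⟨P, haP, rfl⟩
    refine ⟨⟨P.isMaximal.isPrime, (Ideal.span_singleton_le_iff_mem _).2 haP⟩, ?_⟩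
    rintro Q ⟨hQ, haQ⟩ hQP
    have hQ_ne_bot : Q ≠ ⊥ := by
      rintro rfl
      exact ha ((Ideal.span_singleton_le_iff_mem _).1 haQ)
    exact ((hQ.isMaximal hQ_ne_bot).eq_of_le P.isMaximal.ne_top hQP).ge

theorem exists_forall_mem_finset_eq_mk {R : Type*} [CommRing R] (s : Finset (MaximalSpectrum R))
    (f : ∀ P : MaximalSpectrum R, R ⧸ P.asIdeal) :
    ∃ r : R, ∀ P ∈ s, f P = Ideal.Quotient.mk P.asIdeal r := by
  obtain ⟨r, hr⟩ := Ideal.pi_quotient_surjective (I := fun P : s => P.1.asIdeal)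
    (fun P Q h => Ideal.isCoprime_of_isMaximal fun h' => h (Subtype.ext (MaximalSpectrum.ext h')))
    (fun P => f P.1)
  exact ⟨r, fun P hP => (hr ⟨P, hP⟩).symm⟩

namespace NonstandardExtension

variable {E : NonstandardExtension.{u, v}} {I : Type u} {i₀ : E.star I}

namespace Internal

variable {T T₁ T₂ T₃ : I → Type u}

theorem holds_not (P : ∀ i, T i → Prop) (x : E.Internal i₀ T) :
    Holds (fun i a => ¬ P i a) x ↔ ¬ Holds P x :=
  ⟨fun h h' => E.notMem_starSet_compl _ _ h' h,
    (E.mem_starSet_or {z : Σ i, T i | P z.1 z.2} x.1).resolve_left⟩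

theorem holds_and (P Q : ∀ i, T i → Prop) (x : E.Internal i₀ T) :
    Holds (fun i a => P i a ∧ Q i a) x ↔ Holds P x ∧ Holds Q x :=
  ⟨fun h => ⟨h.mono fun _ _ => And.left, h.mono fun _ _ => And.right⟩, fun h => h.1.and h.2⟩

theorem holds_imp (P Q : ∀ i, T i → Prop) (x : E.Internal i₀ T) :
    Holds (fun i a => P i a → Q i a) x ↔ (Holds P x → Holds Q x) := by
  simp only [imp_iff_not_or, or_iff_not_and_not, holds_not, holds_and]

theorem rel_not (R : ∀ i, T i → T₁ i → Prop) (x : E.Internal i₀ T) (y : E.Internal i₀ T₁) :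
    Rel (fun i a b => ¬ R i a b) x y ↔ ¬ Rel R x y :=
  holds_not _ _

theorem rel_map_right (R : ∀ i, T i → T₂ i → Prop) (g : ∀ i, T₁ i → T₂ i)
    (x : E.Internal i₀ T) (y : E.Internal i₀ T₁) :
    Rel R x (map g y) ↔ Rel (fun i a b => R i a (g i b)) x y := by
  obtain ⟨w, rfl, rfl⟩ := exists_map_two x y
  rw [map_map, rel_map, rel_map]

theorem rel_map_left (R : ∀ i, T₂ i → T₁ i → Prop) (g : ∀ i, T i → T₂ i)
    (x : E.Internal i₀ T) (y : E.Internal i₀ T₁) :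
    Rel R (map g x) y ↔ Rel (fun i a b => R i (g i a) b) x y := by
  obtain ⟨w, rfl, rfl⟩ := exists_map_two x y
  rw [map_map, rel_map, rel_map]

theorem rel_self (R : ∀ i, T i → T i → Prop) (x : E.Internal i₀ T) :
    Rel R x x ↔ Holds (fun i a => R i a a) x := by
  simpa only [map_id] using rel_map R (fun _ a => a) (fun _ a => a) x

theorem map_eq_map_iff (f g : ∀ i, T i → T₁ i) (x : E.Internal i₀ T) :
    map f x = map g x ↔ Holds (fun i a => f i a = g i a) x := by
  refine ⟨fun h => ?_, fun h => ?_⟩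
  · exact E.starSet_mono (fun z hz => eq_of_heq (Sigma.mk.inj hz).2)
      (E.mem_starSet_eq (congrArg Subtype.val h))
  · obtain ⟨x, rfl⟩ := x
    obtain ⟨y, rfl⟩ := h
    refine Subtype.ext ?_
    change E.map _ (E.map _ y) = E.map _ (E.map _ y)
    rw [E.map_map, E.map_map]
    exact congrArg (E.map · y) (funext fun z => congrArg (Sigma.mk z.1.1) z.2)

theorem holds_exists (R : ∀ i, T i → T₁ i → Prop) (x : E.Internal i₀ T) :
    Holds (fun i a => ∃ b, R i a b) x ↔ ∃ y, Rel R x y := by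
  refine ⟨?_, ?_⟩
  · obtain ⟨x, rfl⟩ := x
    rintro ⟨u, rfl⟩
    choose c hc using fun z : {z : Σ i, T i | ∃ b, R z.1 z.2 b} => z.2
    let w : E.Internal (E.map Sigma.fst (E.map Subtype.val u)) (fun i => T i × T₁ i) :=
      ⟨E.map (fun z => ⟨z.1.1, z.1.2, c z⟩) u, by rw [E.map_map, E.map_map]⟩
    have map_fst_w : map (fun _ z => z.1) w = ⟨_, rfl⟩ := Subtype.ext (E.map_map _ _ _)
    refine ⟨map (fun _ z => z.2) w, ?_⟩
    rw [← map_fst_w, rel_map]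
    exact E.map_mem_starSet_of_forall _ _ hc u
  · rintro ⟨y, hxy⟩
    obtain ⟨w, rfl, rfl⟩ := exists_map_two x y
    rw [rel_map] at hxy
    exact (holds_map _ _ _).2 (hxy.mono fun _ z h => ⟨z.2, h⟩)

theorem holds_forall (R : ∀ i, T i → T₁ i → Prop) (x : E.Internal i₀ T) :
    Holds (fun i a => ∀ b, R i a b) x ↔ ∀ y, Rel R x y := by
  have h := not_congr (holds_exists (fun i a b => ¬ R i a b) x)
  rw [← holds_not] at h
  simpa only [not_exists, not_not, rel_not] using h

theorem rel_forall_imp (R : ∀ i, T₃ i → T₁ i → Prop) (Q : ∀ i, T₃ i → T₂ i → Prop)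
    (x : E.Internal i₀ T₁) (y : E.Internal i₀ T₂) :
    Rel (fun i a b => ∀ c, R i c a → Q i c b) x y ↔ ∀ z, Rel R z x → Rel Q z y := by
  obtain ⟨w, rfl, rfl⟩ := exists_map_two x y
  rw [rel_map, holds_forall]
  refine forall_congr' fun z => ?_
  obtain ⟨w, rfl, rfl⟩ := exists_map_two w z
  simp only [map_map, rel_map, holds_imp]

section Operations

variable [∀ i, CommRing (T₁ i)] (f g : ∀ i, T i → T₁ i) (x : E.Internal i₀ T)

theorem map_add_map : map f x + map g x = map (fun i a => f i a + g i a) x := map₂_map _ _ _ _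

theorem map_mul_map : map f x * map g x = map (fun i a => f i a * g i a) x := map₂_map _ _ _ _

theorem map_sub_map : map f x - map g x = map (fun i a => f i a - g i a) x := by
  have neg_map : -map g x = map (fun i a => -g i a) x := map_map _ _ _
  simp only [sub_eq_add_neg, neg_map, map_add_map]

theorem zero_eq_map : (0 : E.Internal i₀ T₁) = map (fun _ _ => 0) x := const_eq_map _ _

theorem one_eq_map : (1 : E.Internal i₀ T₁) = map (fun _ _ => 1) x := const_eq_map _ _

theorem map_eq_zero_iff : map f x = 0 ↔ Holds (fun i a => f i a = 0) x := by
  rw [zero_eq_map x, map_eq_map_iff]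

end Operations

theorem eq_zero_iff [∀ i, CommRing (T i)] {x : E.Internal i₀ T} :
    x = 0 ↔ Holds (fun _ a => a = 0) x := by
  rw [← map_eq_zero_iff, map_id]

theorem le_iff_rel [∀ i, Lattice (T i)] {x y : E.Internal i₀ T} :
    x ≤ y ↔ Rel (fun _ a b => a ≤ b) x y := by
  obtain ⟨w, rfl, rfl⟩ := exists_map_two x y
  rw [← inf_eq_left, rel_map]
  change map₂ _ _ _ = _ ↔ _
  simp only [map₂_map, map_eq_map_iff, inf_eq_left]

/-- The internal ring homomorphism given by a family of ring homomorphisms. -/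
noncomputable def mapRingHom [∀ i, CommRing (T i)] [∀ i, CommRing (T₁ i)] (φ : ∀ i, T i →+* T₁ i) :
    E.Internal i₀ T →+* E.Internal i₀ T₁ where
  toFun := map fun i => φ i
  map_one' := (map_const _ _).trans (by simp only [map_one]; rfl)
  map_zero' := (map_const _ _).trans (by simp only [map_zero]; rfl)
  map_mul' x y := by
    obtain ⟨w, rfl, rfl⟩ := exists_map_two x y
    simp only [map_mul_map, map_map, map_mul]
  map_add' x y := by
    obtain ⟨w, rfl, rfl⟩ := exists_map_two x y
    simp only [map_add_map, map_map, map_add]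

section Pullback

variable {J : I → Type u}

/-- The element `x` of the internal set `*T_{i₀}`, regarded as an element of the same internal set
written as `*T_y`, where `y` lies above `i₀` in `*(Σ i, J i)` and the family `T` is pulled back to
one indexed by `Σ i, J i`. It lets elements of `*T_{i₀}` act on the fibre over `y` of a family
that depends on both indices. -/
noncomputable def pullback (x : E.Internal i₀ T) (y : E.Internal i₀ J) :
    E.Internal y.1 (fun j : Σ i, J i => T j.1) :=
  ⟨E.map (fun z : Σ i, T i × J i => (⟨⟨z.1, z.2.2⟩, z.2.1⟩ : Σ j : (Σ i, J i), T j.1))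
    (pair x y).1, by
      rw [E.map_map]
      exact congrArg Subtype.val (map_snd_pair x y)⟩

theorem pullback_map (f : ∀ i, T i → T₁ i) (x : E.Internal i₀ T) (y : E.Internal i₀ J) :
    pullback (map f x) y = map (fun j : Σ i, J i => f j.1) (pullback x y) := by
  have pair_map_left :
      pair (map f x) y = map (fun i (z : T i × J i) => (f i z.1, z.2)) (pair x y) := by
    obtain ⟨w, rfl, rfl⟩ := exists_map_two x y
    simp only [map_map, pair_map]
  apply Subtype.ext
  change E.map _ (pair (map f x) y).1 = E.map _ (E.map _ (pair x y).1)
  rw [pair_map_left]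
  change E.map _ (E.map _ (pair x y).1) = _
  rw [E.map_map, E.map_map]

theorem holds_pullback (P : ∀ i, J i → T i → Prop) (x : E.Internal i₀ T) (y : E.Internal i₀ J) :
    Holds (fun j a => P j.1 j.2 a) (pullback x y) ↔ Rel (fun i a b => P i b a) x y :=
  E.map_mem_starSet _ _ _

/-- `Internal.pullback` as a ring homomorphism. -/
noncomputable def pullbackRingHom [∀ i, CommRing (T i)] (y : E.Internal i₀ J) :
    E.Internal i₀ T →+* E.Internal y.1 (fun j : Σ i, J i => T j.1) where
  toFun x := pullback x y
  map_one' := by rw [one_eq_map y, pullback_map, one_eq_map (pullback y y)]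
  map_zero' := by rw [zero_eq_map y, pullback_map, zero_eq_map (pullback y y)]
  map_mul' x x' := by
    obtain ⟨w, rfl, rfl⟩ := exists_map_two x x'
    simp only [map_mul_map, pullback_map]
  map_add' x x' := by
    obtain ⟨w, rfl, rfl⟩ := exists_map_two x x'
    simp only [map_add_map, pullback_map]

theorem exists_map_apply_pullback_eq {U : (Σ i, J i) → Type u} [∀ j, Nonempty (U j)]
    (y : E.Internal i₀ J) (r : E.Internal y.1 U) :
    ∃ f : E.Internal i₀ (fun i => ∀ b : J i, U ⟨i, b⟩),
      map (fun j (g : ∀ b : J j.1, U ⟨j.1, b⟩) => g j.2) (pullback f y) = r := by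
  classical
  obtain ⟨r, hr⟩ := r
  let extend : (Σ j, U j) → Σ i, (∀ b : J i, U ⟨i, b⟩) × J i := fun z =>
    ⟨z.1.1, Function.update (fun _ => Classical.arbitrary _) z.1.2 z.2, z.1.2⟩
  let w : E.Internal i₀ (fun i => (∀ b : J i, U ⟨i, b⟩) × J i) :=
    ⟨E.map extend r, by rw [E.map_map, ← y.2, ← hr, E.map_map]⟩
  have hy : map (fun _ z => z.2) w = y := by
    apply Subtype.ext
    change E.map _ (E.map extend r) = y.1
    rw [E.map_map, ← hr]
  have hw : pair (map (fun _ z => z.1) w) y = w := by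
    conv_lhs => rw [← hy, pair_map, map_id]
  refine ⟨map (fun _ z => z.1) w, Subtype.ext ?_⟩
  change E.map _ (E.map _ (pair _ y).1) = r
  rw [hw, E.map_map]
  change E.map _ (E.map extend r) = r
  rw [E.map_map]
  simp only [extend, Function.update_self, E.map_id]

end Pullback

end Internal

open Internal

variable {A : I → Type u} [∀ i, CommRing (A i)]

namespace InternalIdeal

variable {J K : E.InternalIdeal i₀ A}

theorem mem_toIdeal {x : E.Internal i₀ A} : x ∈ J.toIdeal ↔ Rel (fun _ a K => a ∈ K) x J := Iff.rfl

theorem toIdeal_le_toIdeal_iff : J.toIdeal ≤ K.toIdeal ↔ J ≤ K :=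
  ((rel_forall_imp _ _ J K).symm.trans le_iff_rel.symm :)

theorem toIdeal_eq_top_iff : J.toIdeal = ⊤ ↔ Holds (fun _ K => K = ⊤) J := by
  rw [Ideal.eq_top_iff_one, mem_toIdeal, one_eq_map J, rel_map_left, rel_self]
  simp only [Ideal.eq_top_iff_one]

theorem toIdeal_sup : (J ⊔ K).toIdeal = J.toIdeal ⊔ K.toIdeal := by
  apply le_antisymm
  · intro x hx
    obtain ⟨w, rfl, rfl, rfl⟩ := exists_map_three x J K
    rw [mem_toIdeal] at hx
    change Rel _ _ (map₂ _ _ _) at hx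
    rw [map₂_map, rel_map] at hx
    have hx_split : Holds (fun i z => ∃ b : A i, b ∈ z.2.1 ∧ z.1 - b ∈ z.2.2) w :=
      hx.mono fun i z hz => by
        obtain ⟨b, hb, c, hc, hbc⟩ := Submodule.mem_sup.1 hz
        exact ⟨b, hb, by rwa [← hbc, add_sub_cancel_left]⟩
    obtain ⟨y, hy⟩ := (holds_exists _ _).1 hx_split
    obtain ⟨w, rfl, rfl⟩ := exists_map_two w y
    rw [rel_map, holds_and] at hy
    simp only [Internal.map_map]
    refine Submodule.mem_sup.2 ⟨Internal.map (fun _ z => z.2) w, ?_, _, ?_, add_sub_cancel _ _⟩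
    · rw [mem_toIdeal, rel_map]
      exact hy.1
    · rw [map_sub_map, mem_toIdeal, rel_map]
      exact hy.2
  · exact sup_le (toIdeal_le_toIdeal_iff.2 le_sup_left) (toIdeal_le_toIdeal_iff.2 le_sup_right)

theorem toIdeal_map_span_singleton (a : E.Internal i₀ A) :
    InternalIdeal.toIdeal (Internal.map (fun _ a => Ideal.span {a}) a) = Ideal.span {a} := by
  apply le_antisymm
  · intro x hx
    rw [mem_toIdeal, rel_map_right] at hx
    obtain ⟨w, rfl, rfl⟩ := exists_map_two x a
    rw [rel_map] at hx
    obtain ⟨y, hy⟩ := (holds_exists (fun i z (b : A i) => b * z.2 = z.1) w).1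
      (hx.mono fun _ _ => Ideal.mem_span_singleton'.1)
    obtain ⟨w, rfl, rfl⟩ := exists_map_two w y
    rw [rel_map, ← map_eq_map_iff] at hy
    rw [Ideal.mem_span_singleton']
    exact ⟨Internal.map (fun _ z => z.2) w, by simpa only [Internal.map_map, map_mul_map] using hy⟩
  · rw [Ideal.span_singleton_le_iff_mem, mem_toIdeal, rel_map_right, rel_self]
    exact holds_of_forall (fun _ => Ideal.mem_span_singleton_self) a

theorem exists_le_internalMax (hJ : J.toIdeal ≠ ⊤) :
    ∃ p : E.InternalMax i₀ A, J.toIdeal ≤ p.toIdeal := by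
  rw [Ne, toIdeal_eq_top_iff, ← holds_not] at hJ
  obtain ⟨p, hp⟩ := (holds_exists (fun i K (P : MaximalSpectrum (A i)) => K ≤ P.asIdeal) J).1 <|
    hJ.mono fun i K hK => by
      obtain ⟨M, hM, hKM⟩ := Ideal.exists_le_maximal K hK
      exact ⟨⟨M, hM⟩, hKM⟩
  exact ⟨p, toIdeal_le_toIdeal_iff.2 (le_iff_rel.2 ((rel_map_right _ _ _ _).2 hp))⟩

end InternalIdeal

theorem IsInternalIdeal.of_fg {N : Ideal (E.Internal i₀ A)} (hN : N.FG) : IsInternalIdeal N := by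
  induction N, hN using Submodule.fg_induction with
  | singleton a => exact ⟨_, InternalIdeal.toIdeal_map_span_singleton a⟩
  | sup N₁ N₂ _ _ hN₁ hN₂ =>
    obtain ⟨J, rfl⟩ := hN₁
    obtain ⟨K, rfl⟩ := hN₂
    exact ⟨J ⊔ K, InternalIdeal.toIdeal_sup⟩

namespace InternalMax

variable {p q : E.InternalMax i₀ A} {S T : E.HyperfiniteSets i₀ A}

theorem mem_toIdeal {x : E.Internal i₀ A} :
    x ∈ p.toIdeal ↔ Rel (fun _ a P => a ∈ P.asIdeal) x p :=
  InternalIdeal.mem_toIdeal.trans (rel_map_right _ _ _ _)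

theorem toIdeal_ne_top (p : E.InternalMax i₀ A) : p.toIdeal ≠ ⊤ := by
  rw [InternalMax.toIdeal, Ne, InternalIdeal.toIdeal_eq_top_iff, ← holds_not, holds_map]
  exact holds_of_forall (fun _ P => P.isMaximal.ne_top) p

instance isMaximal_toIdeal (p : E.InternalMax i₀ A) : p.toIdeal.IsMaximal := by
  refine Ideal.isMaximal_iff.2 ⟨(Ideal.ne_top_iff_one _).1 p.toIdeal_ne_top, ?_⟩
  intro J x hpJ hxp hxJ
  suffices ∃ y, 1 - y * x ∈ p.toIdeal by
    obtain ⟨y, hy⟩ := this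
    rw [← sub_add_cancel 1 (y * x)]
    exact add_mem (hpJ hy) (J.mul_mem_left y hxJ)
  rw [mem_toIdeal] at hxp
  obtain ⟨w, rfl, rfl⟩ := exists_map_two x p
  rw [rel_map, ← holds_not] at hxp
  obtain ⟨y, hy⟩ := (holds_exists (fun i z (b : A i) => 1 - b * z.1 ∈ z.2.asIdeal) w).1 <|
    hxp.mono fun i z hz => by
      obtain ⟨b, c, hc, hbc⟩ := z.2.isMaximal.exists_inv hz
      exact ⟨b, by rwa [← hbc, add_sub_cancel_left]⟩
  obtain ⟨w, rfl, rfl⟩ := exists_map_two w y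
  refine ⟨Internal.map (fun _ z => z.2) w, ?_⟩
  rw [rel_map] at hy
  simpa only [mem_toIdeal, Internal.map_map, one_eq_map w, map_mul_map, map_sub_map, rel_map]
    using hy

theorem toIdeal_injective :
    Function.Injective (InternalMax.toIdeal : E.InternalMax i₀ A → Ideal (E.Internal i₀ A)) := by
  intro p q hpq
  have asIdeal_eq : Internal.map (fun _ P => P.asIdeal) p = Internal.map (fun _ Q => Q.asIdeal) q :=
    le_antisymm (InternalIdeal.toIdeal_le_toIdeal_iff.1 hpq.le)
      (InternalIdeal.toIdeal_le_toIdeal_iff.1 hpq.ge)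
  obtain ⟨w, rfl, rfl⟩ := exists_map_two p q
  rw [Internal.map_map, Internal.map_map, map_eq_map_iff] at asIdeal_eq
  exact (map_eq_map_iff _ _ _).2 (asIdeal_eq.mono fun _ _ => MaximalSpectrum.ext)

theorem memSet_singleton : p.MemSet q.singleton ↔ p = q := by
  obtain ⟨w, rfl, rfl⟩ := exists_map_two p q
  rw [InternalMax.MemSet, InternalMax.singleton, Internal.map_map, rel_map, map_eq_map_iff]
  simp only [Finset.mem_singleton]

theorem memSet_singleton_self (p : E.InternalMax i₀ A) : p.MemSet p.singleton :=
  memSet_singleton.2 rfl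

theorem memSet_inf : p.MemSet (S ⊓ T) ↔ p.MemSet S ∧ p.MemSet T := by
  classical
  obtain ⟨w, rfl, rfl, rfl⟩ := exists_map_three p S T
  change Rel _ _ (map₂ _ _ _) ↔ _
  simp only [InternalMax.MemSet, map₂_map, rel_map, ← holds_and, Finset.inf_eq_inter,
    Finset.mem_inter]

theorem not_memSet_const_empty (p : E.InternalMax i₀ A) :
    ¬ p.MemSet (const fun _ => ∅ : E.HyperfiniteSets i₀ A) := by
  rw [InternalMax.MemSet, const_eq_map _ p, rel_map_right, ← rel_not]
  exact holds_of_forall (fun _ _ => Finset.notMem_empty _) _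

end InternalMax

theorem HyperfiniteSets.le_iff {S T : E.HyperfiniteSets i₀ A} :
    S ≤ T ↔ ∀ p : E.InternalMax i₀ A, p.MemSet S → p.MemSet T := by
  classical
  exact (le_iff_rel.trans (rel_forall_imp _ _ S T) :)

theorem exists_internalMax_of_finset_subset {N : Ideal (E.Internal i₀ A)} (hN : N ≠ ⊤)
    {t : Finset (E.Internal i₀ A)} (ht : ∀ a ∈ t, a ∈ N) :
    ∃ p : E.InternalMax i₀ A, ∀ a ∈ t, a ∈ p.toIdeal := by
  obtain ⟨J, hJ⟩ := IsInternalIdeal.of_fg ⟨t, rfl⟩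
  have hJN : J.toIdeal ≤ N := hJ.le.trans (Ideal.span_le.2 ht)
  obtain ⟨p, hp⟩ := J.exists_le_internalMax (ne_top_of_le_ne_top hN hJN)
  exact ⟨p, fun a ha => hp (hJ.ge (Ideal.subset_span ha))⟩

theorem IsInternalIdeal.exists_internalMax {m : Ideal (E.Internal i₀ A)} (hm : m.IsMaximal)
    (h : IsInternalIdeal m) : ∃ p : E.InternalMax i₀ A, p.toIdeal = m := by
  obtain ⟨J, rfl⟩ := h
  obtain ⟨p, hp⟩ := J.exists_le_internalMax hm.ne_top
  exact ⟨p, (hm.eq_of_le p.toIdeal_ne_top hp).symm⟩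

open Classical in
/-- The hyperfinite set `V(a)` of the internal maximal ideals that contain `a`, for `a ≠ 0`. Where
infinitely many maximal ideals contain `a` the value is the empty set. -/
noncomputable def zeroSet (a : E.Internal i₀ A) : E.HyperfiniteSets i₀ A :=
  Internal.map (fun i x =>
    if h : {P : MaximalSpectrum (A i) | x ∈ P.asIdeal}.Finite then h.toFinset else ∅) a

theorem memSet_zeroSet [∀ i, HasFiniteCharacter (A i)] {a : E.Internal i₀ A} (ha : a ≠ 0)
    (p : E.InternalMax i₀ A) : p.MemSet (zeroSet a) ↔ a ∈ p.toIdeal := by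
  rw [Ne, eq_zero_iff, ← holds_not] at ha
  rw [InternalMax.mem_toIdeal]
  obtain ⟨w, rfl, rfl⟩ := exists_map_two p a
  simp only [InternalMax.MemSet, zeroSet, Internal.map_map, rel_map, holds_map] at ha ⊢
  rw [iff_iff_implies_and_implies, ← holds_imp, ← holds_imp, ← holds_and]
  refine ha.mono fun i z hz => ?_
  rw [dif_pos (HasFiniteCharacter.finite_setOf_mem hz), Set.Finite.mem_toFinset, ← iff_def]
  rfl

section Evaluation

/-- Evaluation of internal functions at an internal maximal ideal, as a ring homomorphism. -/
noncomputable def evalHom (p : E.InternalMax i₀ A) : E.InternalProd i₀ A →+* InternalResidue p :=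
  (mapRingHom fun j : Σ i, MaximalSpectrum (A i) =>
    Pi.evalRingHom (fun P => A j.1 ⧸ P.asIdeal) j.2).comp (pullbackRingHom p)

theorem evalHom_apply (p : E.InternalMax i₀ A) (f : E.InternalProd i₀ A) :
    evalHom p f = f.eval p :=
  Subtype.ext (E.map_map _ _ _)

theorem evalHom_surjective (p : E.InternalMax i₀ A) : Function.Surjective (evalHom p) :=
  exists_map_apply_pullback_eq p

theorem eval_eq_zero_iff {f : E.InternalProd i₀ A} {p : E.InternalMax i₀ A} :
    f.eval p = 0 ↔ Rel (fun _ f P => f P = 0) f p := by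
  rw [← evalHom_apply]
  exact (Internal.map_eq_zero_iff _ _).trans
    (holds_pullback (fun i P (f : ∀ P : MaximalSpectrum (A i), A i ⧸ P.asIdeal) => f P = 0) f p)

/-- The diagonal map, as a ring homomorphism. -/
noncomputable def diagHom : E.Internal i₀ A →+* E.InternalProd i₀ A :=
  mapRingHom fun _ => RingHom.pi fun P => Ideal.Quotient.mk P.asIdeal

theorem eval_diag_eq_zero_iff {b : E.Internal i₀ A} {p : E.InternalMax i₀ A} :
    (diag b).eval p = 0 ↔ b ∈ p.toIdeal := by
  rw [eval_eq_zero_iff, InternalMax.mem_toIdeal]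
  obtain ⟨w, rfl, rfl⟩ := exists_map_two b p
  simp only [diag, Internal.map_map, rel_map, Ideal.Quotient.eq_zero_iff_mem]

theorem exists_forall_memSet_eval_sub_diag_eq_zero (f : E.InternalProd i₀ A)
    (S : E.HyperfiniteSets i₀ A) :
    ∃ b : E.Internal i₀ A, ∀ p : E.InternalMax i₀ A, p.MemSet S → (f - diag b).eval p = 0 := by
  obtain ⟨w, rfl, rfl⟩ := exists_map_two f S
  obtain ⟨b, hb⟩ := (holds_exists (fun i z (b : A i) => ∀ P : MaximalSpectrum (A i),
    P ∈ z.2 → z.1 P = Ideal.Quotient.mk P.asIdeal b) w).1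
      (holds_of_forall (fun _ z => exists_forall_mem_finset_eq_mk z.2 z.1) w)
  refine ⟨b, fun p => ?_⟩
  rw [eval_eq_zero_iff]
  obtain ⟨w, rfl, rfl⟩ := exists_map_two w b
  rw [rel_map, holds_forall] at hb
  have hbp := hb p
  obtain ⟨w, rfl, rfl⟩ := exists_map_two w p
  simpa only [InternalMax.MemSet, diag, Internal.map_map, map_sub_map, rel_map, ← holds_imp,
    Pi.sub_apply, sub_eq_zero] using hbp

open Classical in
/-- The internal characteristic function of a hyperfinite set `S`. -/
noncomputable def indicator (S : E.HyperfiniteSets i₀ A) : E.InternalProd i₀ A :=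
  Internal.map (fun _ s P => if P ∈ s then 1 else 0) S

theorem isIdempotentElem_indicator (S : E.HyperfiniteSets i₀ A) :
    IsIdempotentElem (indicator S) := by
  rw [IsIdempotentElem, indicator, map_mul_map]
  congr 1
  funext i s P
  by_cases hP : P ∈ s <;> simp [hP]

theorem eval_indicator_eq_zero_iff {S : E.HyperfiniteSets i₀ A} {p : E.InternalMax i₀ A} :
    (indicator S).eval p = 0 ↔ ¬ p.MemSet S := by
  rw [eval_eq_zero_iff]
  obtain ⟨w, rfl, rfl⟩ := exists_map_two S p
  simp only [indicator, InternalMax.MemSet, Internal.map_map, rel_map, ← holds_not,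
    ite_eq_right_iff, one_ne_zero, imp_false]

theorem eval_one_sub_indicator_eq_zero_iff {S : E.HyperfiniteSets i₀ A} {p : E.InternalMax i₀ A} :
    (1 - indicator S).eval p = 0 ↔ p.MemSet S := by
  rw [eval_eq_zero_iff]
  obtain ⟨w, rfl, rfl⟩ := exists_map_two S p
  simp only [indicator, InternalMax.MemSet, Internal.map_map, one_eq_map w, map_sub_map, rel_map,
    Pi.sub_apply, Pi.one_apply, sub_eq_zero, eq_comm (a := (1 : _ ⧸ _)), ite_eq_left_iff,
    zero_ne_one, imp_false, not_not]

end Evaluation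

section Filter

variable {m : Ideal (E.Internal i₀ A)} {S T : E.HyperfiniteSets i₀ A}

theorem mem_filterOf_of_forall_memSet (hT : T ∈ filterOf m)
    (hTS : ∀ p : E.InternalMax i₀ A, p.MemSet T → p.MemSet S) : S ∈ filterOf m := by
  obtain ⟨t, ht, hT⟩ := hT
  exact ⟨t, ht, fun p hp => hTS p (hT p hp)⟩

theorem isLatticeFilter_filterOf (m : Ideal (E.Internal i₀ A)) :
    IsLatticeFilter (filterOf m) where
  inf_mem := by
    classical
    rintro S ⟨s, hs, hS⟩ T ⟨t, ht, hT⟩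
    refine ⟨s ∪ t, fun a ha => (Finset.mem_union.1 ha).elim (hs a) (ht a), fun p hp => ?_⟩
    exact InternalMax.memSet_inf.2 ⟨hS p fun a ha => hp a (Finset.mem_union_left _ ha),
      hT p fun a ha => hp a (Finset.mem_union_right _ ha)⟩
  sup_mem _ hS _ := mem_filterOf_of_forall_memSet hS (HyperfiniteSets.le_iff.1 le_sup_left)

theorem exists_memSet_of_mem_filterOf (hm : m ≠ ⊤) (hS : S ∈ filterOf m) {a : E.Internal i₀ A}
    (ha : a ∈ m) : ∃ p : E.InternalMax i₀ A, p.MemSet S ∧ a ∈ p.toIdeal := by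
  classical
  obtain ⟨t, ht, hS⟩ := hS
  obtain ⟨p, hp⟩ := exists_internalMax_of_finset_subset hm
    (Finset.forall_mem_insert _ _ _ |>.2 ⟨ha, ht⟩)
  rw [Finset.forall_mem_insert] at hp
  exact ⟨p, hS p hp.2, hp.1⟩

theorem mem_of_forall_memSet (hm : m.IsMaximal) (hS : S ∈ filterOf m) {a : E.Internal i₀ A}
    (ha : ∀ p : E.InternalMax i₀ A, p.MemSet S → a ∈ p.toIdeal) : a ∈ m := by
  by_contra ham
  obtain ⟨b, c, hc, hbc⟩ := hm.exists_inv ham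
  obtain ⟨p, hpS, hcp⟩ := exists_memSet_of_mem_filterOf hm.ne_top hS hc
  refine p.toIdeal_ne_top ((Ideal.eq_top_iff_one _).2 ?_)
  rw [← hbc]
  exact add_mem (Ideal.mul_mem_left _ b (ha p hpS)) hcp

theorem mem_vanishingIdeal_iff {F : Set (E.HyperfiniteSets i₀ A)} (hF : IsLatticeFilter F)
    (hF_nonempty : F.Nonempty) {f : E.InternalProd i₀ A} :
    f ∈ vanishingIdeal F ↔ ∃ S ∈ F, ∀ p : E.InternalMax i₀ A, p.MemSet S → f.eval p = 0 := by
  refine ⟨fun hf => ?_, fun hf => Ideal.subset_span hf⟩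
  simp only [← evalHom_apply]
  induction hf using Submodule.span_induction with
  | mem f hf =>
    simp only [evalHom_apply]
    exact hf
  | zero =>
    obtain ⟨S, hS⟩ := hF_nonempty
    exact ⟨S, hS, fun p _ => map_zero _⟩
  | add f g _ _ hf hg =>
    obtain ⟨S, hS, hfS⟩ := hf
    obtain ⟨T, hT, hgT⟩ := hg
    refine ⟨S ⊓ T, hF.inf_mem S hS T hT, fun p hp => ?_⟩
    rw [InternalMax.memSet_inf] at hp
    rw [map_add, hfS p hp.1, hgT p hp.2, add_zero]
  | smul g f _ hf =>
    obtain ⟨S, hS, hfS⟩ := hf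
    refine ⟨S, hS, fun p hp => ?_⟩
    rw [smul_eq_mul, map_mul, hfS p hp, mul_zero]

theorem singleton_mem_filterOf_of_toIdeal_eq_bot (p : E.InternalMax i₀ A)
    (hp : p.toIdeal = ⊥) : p.singleton ∈ filterOf m := by
  refine ⟨∅, fun _ h => absurd h (Finset.notMem_empty _), fun q _ => ?_⟩
  have hpq : p.toIdeal = q.toIdeal :=
    p.isMaximal_toIdeal.eq_of_le q.toIdeal_ne_top (hp.trans_le bot_le)
  exact InternalMax.memSet_singleton.2 (InternalMax.toIdeal_injective hpq.symm)

variable [∀ i, HasFiniteCharacter (A i)]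

theorem zeroSet_mem_filterOf {a : E.Internal i₀ A} (ha : a ≠ 0) (ham : a ∈ m) :
    zeroSet a ∈ filterOf m := by
  refine ⟨{a}, by simpa only [Finset.mem_singleton, forall_eq] using ham, fun p hp => ?_⟩
  exact (memSet_zeroSet ha p).2 (hp a (Finset.mem_singleton_self a))

theorem filterOf_nonempty (hm : m.IsMaximal) : (filterOf m).Nonempty := by
  obtain rfl | hm_bot := eq_or_ne m ⊥
  · have bot_internal : IsInternalIdeal (⊥ : Ideal (E.Internal i₀ A)) :=
      IsInternalIdeal.of_fg Submodule.fg_bot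
    obtain ⟨p, hp⟩ := bot_internal.exists_internalMax hm
    exact ⟨_, singleton_mem_filterOf_of_toIdeal_eq_bot p hp⟩
  · obtain ⟨a, ham, ha⟩ := Submodule.exists_mem_ne_zero_of_ne_bot hm_bot
    exact ⟨_, zeroSet_mem_filterOf ha ham⟩

theorem mem_vanishingIdeal_filterOf_iff (hm : m.IsMaximal) {f : E.InternalProd i₀ A} :
    f ∈ vanishingIdeal (filterOf m) ↔
      ∃ S ∈ filterOf m, ∀ p : E.InternalMax i₀ A, p.MemSet S → f.eval p = 0 :=
  mem_vanishingIdeal_iff (isLatticeFilter_filterOf m) (filterOf_nonempty hm)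

theorem mem_iff_eq_zero_or_exists_mem_filterOf (hm : m.IsMaximal) (a : E.Internal i₀ A) :
    a ∈ m ↔ a = 0 ∨ ∃ S ∈ filterOf m, ∀ p : E.InternalMax i₀ A, p.MemSet S ↔ a ∈ p.toIdeal := by
  refine ⟨fun ham => or_iff_not_imp_left.2 fun ha => ?_, ?_⟩
  · exact ⟨zeroSet a, zeroSet_mem_filterOf ha ham, memSet_zeroSet ha⟩
  · rintro (rfl | ⟨S, hS, h⟩)
    · exact m.zero_mem
    · exact mem_of_forall_memSet hm hS fun p => (h p).1

theorem diag_mem_vanishingIdeal_iff (hm : m.IsMaximal) {b : E.Internal i₀ A} :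
    diag b ∈ vanishingIdeal (filterOf m) ↔ b ∈ m := by
  simp only [mem_vanishingIdeal_filterOf_iff hm, eval_diag_eq_zero_iff]
  refine ⟨fun ⟨S, hS, hb⟩ => mem_of_forall_memSet hm hS hb, fun hb => ?_⟩
  obtain rfl | ⟨S, hS, hb⟩ := (mem_iff_eq_zero_or_exists_mem_filterOf hm b).1 hb
  · obtain ⟨S, hS⟩ := filterOf_nonempty hm
    exact ⟨S, hS, fun p _ => p.toIdeal.zero_mem⟩
  · exact ⟨S, hS, fun p => (hb p).1⟩

theorem mk_comp_diagHom_surjective (hm : m.IsMaximal) :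
    Function.Surjective ((Ideal.Quotient.mk (vanishingIdeal (filterOf m))).comp diagHom) := by
  intro x
  obtain ⟨f, rfl⟩ := Ideal.Quotient.mk_surjective x
  obtain ⟨S, hS⟩ := filterOf_nonempty hm
  obtain ⟨b, hb⟩ := exists_forall_memSet_eval_sub_diag_eq_zero f S
  refine ⟨b, Eq.symm ?_⟩
  exact (Ideal.Quotient.mk_eq_mk_iff_sub_mem _ _).2
    ((mem_vanishingIdeal_filterOf_iff hm).2 ⟨S, hS, hb⟩)

theorem ker_mk_comp_diagHom (hm : m.IsMaximal) :
    RingHom.ker ((Ideal.Quotient.mk (vanishingIdeal (filterOf m))).comp diagHom) = m :=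
  Ideal.ext fun _ => Ideal.Quotient.eq_zero_iff_mem.trans (diag_mem_vanishingIdeal_iff hm)

/-- The isomorphism `B/m ≃ (*∏ B/𝔭) / F` induced by the diagonal map. -/
noncomputable def quotientEquivUltraproduct (hm : m.IsMaximal) :
    (E.Internal i₀ A ⧸ m) ≃+* Ultraproduct (filterOf m) :=
  (Ideal.quotEquivOfEq (ker_mk_comp_diagHom hm).symm).trans
    (RingHom.quotientKerEquivOfSurjective (mk_comp_diagHom_surjective hm))

theorem quotientEquivUltraproduct_mk (hm : m.IsMaximal) (b : E.Internal i₀ A) :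
    quotientEquivUltraproduct hm (Ideal.Quotient.mk m b) = Ideal.Quotient.mk _ (diag b) :=
  rfl

theorem isPrime_vanishingIdeal_filterOf (hm : m.IsMaximal) :
    (vanishingIdeal (filterOf m)).IsPrime := by
  have : IsDomain (E.Internal i₀ A ⧸ m) := (Ideal.Quotient.isDomain_iff_prime m).2 hm.isPrime
  rw [← Ideal.Quotient.isDomain_iff_prime]
  exact (quotientEquivUltraproduct hm).symm.toMulEquiv.isDomain _

theorem mem_filterOf_or_exists_disjoint (hm : m.IsMaximal) (S : E.HyperfiniteSets i₀ A) :
    S ∈ filterOf m ∨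
      ∃ T ∈ filterOf m, ∀ p : E.InternalMax i₀ A, p.MemSet T → ¬ p.MemSet S := by
  have mul_mem : indicator S * (1 - indicator S) ∈ vanishingIdeal (filterOf m) := by
    rw [(isIdempotentElem_indicator S).mul_one_sub_self]
    exact zero_mem _
  obtain h | h := (isPrime_vanishingIdeal_filterOf hm).mem_or_mem mul_mem <;>
    obtain ⟨T, hT, hTS⟩ := (mem_vanishingIdeal_filterOf_iff hm).1 h
  · exact .inr ⟨T, hT, fun p hp => eval_indicator_eq_zero_iff.1 (hTS p hp)⟩
  · exact .inl (mem_filterOf_of_forall_memSet hT fun p hp =>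
      eval_one_sub_indicator_eq_zero_iff.1 (hTS p hp))

theorem isLatticeUltrafilter_filterOf (hm : m.IsMaximal) : IsLatticeUltrafilter (filterOf m) := by
  refine ⟨⟨isLatticeFilter_filterOf m, fun h_univ => ?_⟩, fun G ⟨hG, hG_ne_univ⟩ hle S hS => ?_⟩
  · obtain ⟨p, hp, -⟩ :=
      exists_memSet_of_mem_filterOf hm.ne_top (h_univ ▸ Set.mem_univ _) m.zero_mem
    exact p.not_memSet_const_empty hp
  · refine (mem_filterOf_or_exists_disjoint hm S).resolve_right fun ⟨T, hT, hTS⟩ => ?_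
    refine hG_ne_univ (Set.eq_univ_of_forall fun X => ?_)
    have inf_le : S ⊓ T ≤ X := HyperfiniteSets.le_iff.2 fun p hp =>
      absurd (InternalMax.memSet_inf.1 hp).1 (hTS p (InternalMax.memSet_inf.1 hp).2)
    rw [← sup_eq_right.2 inf_le]
    exact hG.sup_mem _ (hG.inf_mem _ hS _ (hle hT)) X

theorem isLeast_singleton_filterOf (p : E.InternalMax i₀ A) :
    IsLeast (filterOf p.toIdeal) p.singleton := by
  have memSet_of_mem {S : E.HyperfiniteSets i₀ A} : S ∈ filterOf p.toIdeal → p.MemSet S :=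
    fun ⟨_, ht, hS⟩ => hS p ht
  refine ⟨?_, fun S hS => HyperfiniteSets.le_iff.2 fun q hq => ?_⟩
  · refine (mem_filterOf_or_exists_disjoint p.isMaximal_toIdeal _).resolve_right ?_
    exact fun ⟨T, hT, hTp⟩ => hTp p (memSet_of_mem hT) p.memSet_singleton_self
  · rw [InternalMax.memSet_singleton.1 hq]
    exact memSet_of_mem hS

theorem ker_evalHom (p : E.InternalMax i₀ A) :
    RingHom.ker (evalHom p) = vanishingIdeal (filterOf p.toIdeal) := by
  ext f
  rw [RingHom.mem_ker, evalHom_apply, mem_vanishingIdeal_filterOf_iff p.isMaximal_toIdeal]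
  refine ⟨fun hf => ⟨_, (isLeast_singleton_filterOf p).1, fun q hq => ?_⟩, fun ⟨S, hS, hf⟩ => ?_⟩
  · rwa [InternalMax.memSet_singleton.1 hq]
  · exact hf p (HyperfiniteSets.le_iff.1 ((isLeast_singleton_filterOf p).2 hS) p
      p.memSet_singleton_self)

/-- The isomorphism `(*∏ B/𝔭) / F ≃ B/p` induced by evaluation at `p`, where `F` belongs to `p`. -/
noncomputable def ultraproductEquivResidue (p : E.InternalMax i₀ A) :
    Ultraproduct (filterOf p.toIdeal) ≃+* InternalResidue p :=
  (Ideal.quotEquivOfEq (ker_evalHom p).symm).trans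
    (RingHom.quotientKerEquivOfSurjective (evalHom_surjective p))

theorem ultraproductEquivResidue_mk (p : E.InternalMax i₀ A) (f : E.InternalProd i₀ A) :
    ultraproductEquivResidue p (Ideal.Quotient.mk _ f) = f.eval p :=
  evalHom_apply p f

end Filter

end NonstandardExtension

open NonstandardExtension in
theorem mainTheorem4_general (E : NonstandardExtension.{u, v}) {I : Type u} (i₀ : E.star I)
    (A : I → Type u) [∀ i, CommRing (A i)] [∀ i, HasFiniteCharacter (A i)]
    (m : Ideal (E.Internal i₀ A)) (hm : m.IsMaximal) :
    IsLatticeUltrafilter (filterOf m) ∧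
    (∀ a, a ∈ m ↔ a = 0 ∨ ∃ S ∈ filterOf m, ∀ p : E.InternalMax i₀ A,
      p.MemSet S ↔ a ∈ p.toIdeal) ∧
    (∃ e : (E.Internal i₀ A ⧸ m) ≃+* Ultraproduct (filterOf m),
      ∀ b, e (Ideal.Quotient.mk m b) = Ideal.Quotient.mk _ (diag b)) ∧
    (IsInternalIdeal m →
      IsPrincipalFilter (filterOf m) ∧
      ∃ p : E.InternalMax i₀ A, p.toIdeal = m ∧ IsLeast (filterOf m) p.singleton ∧
        (∃ e : Ultraproduct (filterOf m) ≃+* InternalResidue p,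
          ∀ f, e (Ideal.Quotient.mk _ f) = f.eval p) ∧
        (∃ e : (E.Internal i₀ A ⧸ m) ≃+* InternalResidue p,
          ∀ b, e (Ideal.Quotient.mk m b) = (diag b).eval p)) := by
  refine ⟨isLatticeUltrafilter_filterOf hm, mem_iff_eq_zero_or_exists_mem_filterOf hm,
    ⟨quotientEquivUltraproduct hm, quotientEquivUltraproduct_mk hm⟩, fun hm_internal => ?_⟩
  obtain ⟨p, rfl⟩ := hm_internal.exists_internalMax hm
  refine ⟨⟨_, isLeast_singleton_filterOf p⟩, p, rfl, isLeast_singleton_filterOf p,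
    ⟨ultraproductEquivResidue p, ultraproductEquivResidue_mk p⟩,
    (quotientEquivUltraproduct hm).trans (ultraproductEquivResidue p), fun b => ?_⟩
  rw [RingEquiv.trans_apply, quotientEquivUltraproduct_mk, ultraproductEquivResidue_mk]

theorem mainTheorem4 (E : NonstandardExtension.{u, v}) {I : Type u} (i₀ : E.star I)
    (A : I → Type u) [∀ i, CommRing (A i)] [∀ i, IsDedekindDomain (A i)]
    (m : Ideal (E.Internal i₀ A)) (hm : m.IsMaximal) :
    IsLatticeUltrafilter (NonstandardExtension.filterOf m) ∧
    (∀ a, a ∈ m ↔ a = 0 ∨ ∃ S ∈ NonstandardExtension.filterOf m, ∀ p : E.InternalMax i₀ A,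
      p.MemSet S ↔ a ∈ p.toIdeal) ∧
    (∃ e : (E.Internal i₀ A ⧸ m) ≃+* NonstandardExtension.Ultraproduct (NonstandardExtension.filterOf m),
      ∀ b, e (Ideal.Quotient.mk m b) = Ideal.Quotient.mk _ (NonstandardExtension.diag b)) ∧
    (NonstandardExtension.IsInternalIdeal m →
      IsPrincipalFilter (NonstandardExtension.filterOf m) ∧
      ∃ p : E.InternalMax i₀ A, p.toIdeal = m ∧ IsLeast (NonstandardExtension.filterOf m) p.singleton ∧
        (∃ e : NonstandardExtension.Ultraproduct (NonstandardExtension.filterOf m) ≃+* NonstandardExtension.InternalResidue p,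
          ∀ f, e (Ideal.Quotient.mk _ f) = f.eval p) ∧
        (∃ e : (E.Internal i₀ A ⧸ m) ≃+* NonstandardExtension.InternalResidue p,
          ∀ b, e (Ideal.Quotient.mk m b) = (NonstandardExtension.diag b).eval p)) :=
  mainTheorem4_general E i₀ A m hm
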